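/- Logarithms are natural. The boxicity $\mathrm{box}(H)$ of a finite simple graph $H$ is the minimum integer $n\ge 0$ such that $H$ is the intersection graph of boxes in $\mathbb{R}^n$, that is, there are boxes $(B_v)_{v\in V(H)}$, each a Cartesian product $I_1\times\dots\times I_n$ of nonempty real intervals, such that distinct vertices $v,w$ are adjacent in $H$ if and only if $B_v\cap B_w\neq\emptyset$. Let $G$ be a finite bipartite graph with bipartition $\{A,B\}$, where vertices in $A$ have degree at most $d$ and vertices in $B$ have degree at most $\Delta$, for some integers $\Delta\ge d\ge 2$. Let $G'$ be the graph obtained from $G$ by adding a clique on $A$ and a clique on $B$. Then, as $d\to\infty$, $$\mathrm{box}(G')\le (60+o(1))\,d\,\log(d\Delta)\,\log\log(\Delta)\,(2e)^{\sqrt{\log d}},$$ where the $o(1)$ term depends only on $d$: for every $\varepsilon>0$ there is $d_0$ such that for all integers $\Delta\ge d\ge\max(d_0,2)$ and every such $G$, the bound holds with $60+\varepsilon$ in place of $60+o(1)$. -/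

import Mathlib

/-- A box in `ℝⁿ`: a Cartesian product `I₁ × ⋯ × Iₙ` of nonempty (not necessarily bounded or
closed) intervals of the real line. The intervals are the order-connected sets. -/
def IsBox {n : ℕ} (S : Set (Fin n → ℝ)) : Prop :=
  ∃ I : Fin n → Set ℝ, (∀ i, (I i).Nonempty ∧ (I i).OrdConnected) ∧ S = Set.univ.pi I

/-- `G` is the intersection graph of boxes in `ℝⁿ`: two distinct vertices are adjacent if and only
if their boxes intersect. -/
def HasBoxRepresentation {V : Type*} (G : SimpleGraph V) (n : ℕ) : Prop :=
  ∃ box : V → Set (Fin n → ℝ), (∀ v, IsBox (box v)) ∧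
    ∀ v w, v ≠ w → (G.Adj v w ↔ (box v ∩ box w).Nonempty)

/-- The boxicity of `G`: the minimum `n` such that `G` is the intersection graph of boxes
in `ℝⁿ`. The minimum exists for finite graphs, see `exists_hasBoxRepresentation`. -/
noncomputable def boxicity {V : Type*} (G : SimpleGraph V) : ℕ :=
  sInf {n : ℕ | HasBoxRepresentation G n}

/-- The graph `G⟨X, Y⟩`: add to `G` an edge between distinct vertices `v` and `w` whenever both lie
outside `X` or both lie outside `Y`. If `X` and `Y` partition the vertex set, then this adds
a clique on `X` and a clique on `Y`. -/
def addCliques {V : Type*} (G : SimpleGraph V) (X Y : Set V) : SimpleGraph V where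
  Adj v w := G.Adj v w ∨ (v ≠ w ∧ ((v ∉ X ∧ w ∉ X) ∨ (v ∉ Y ∧ w ∉ Y)))
  symm := ⟨by
    rintro v w (h | ⟨h, h' | h'⟩)
    · exact Or.inl h.symm
    · exact Or.inr ⟨h.symm, Or.inl h'.symm⟩
    · exact Or.inr ⟨h.symm, Or.inr h'.symm⟩⟩
  loopless := ⟨by
    rintro v (h | ⟨h, -⟩)
    · exact G.loopless.irrefl v h
    · exact h rfl⟩

/-- Every finite graph is the intersection graph of boxes in some `ℝⁿ`. -/
theorem exists_hasBoxRepresentation {V : Type*} [Finite V] (G : SimpleGraph V) :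
    ∃ n : ℕ, HasBoxRepresentation G n := by
  classical
  obtain ⟨n, ⟨e⟩⟩ := Finite.exists_equiv_fin V
  let I : V → Fin n → Set ℝ := fun v i =>
    if v = e.symm i then Set.Icc 0 0 else if G.Adj v (e.symm i) then Set.Icc 0 1 else Set.Icc 1 1
  refine ⟨n, fun v => Set.univ.pi (I v), fun v => ⟨I v, fun i => ?_, rfl⟩, fun v w hvw => ?_⟩
  · simp only [I]
    split_ifs
    · exact ⟨⟨0, by simp⟩, Set.ordConnected_Icc⟩
    · exact ⟨⟨0, by simp⟩, Set.ordConnected_Icc⟩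
    · exact ⟨⟨1, by simp⟩, Set.ordConnected_Icc⟩
  · constructor
    · intro h
      refine ⟨fun i => if v = e.symm i ∨ w = e.symm i then 0 else 1, ?_, ?_⟩
      · intro i _
        by_cases h1 : v = e.symm i
        · simp [I, h1]
        · by_cases h2 : w = e.symm i
          · simp [I, h1, ← h2, h, hvw]
          · by_cases h3 : G.Adj v (e.symm i) <;> simp [I, h1, h2, h3]
      · intro i _
        by_cases h2 : w = e.symm i
        · simp [I, h2]
        · by_cases h1 : v = e.symm i
          · simp [I, ← h1, h.symm, hvw.symm]
          · by_cases h3 : G.Adj w (e.symm i) <;> simp [I, h1, h2, h3]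
    · rintro ⟨x, hxv, hxw⟩
      by_contra h
      have h1 := hxv (e v) (Set.mem_univ _)
      have h2 := hxw (e v) (Set.mem_univ _)
      have h' : ¬ G.Adj w v := fun h3 => h h3.symm
      simp only [I, Equiv.symm_apply_apply, if_true, hvw.symm, h', if_false, Set.mem_Icc] at h1 h2
      linarith [h1.2, h2.1]

/-- The minimum in the definition of boxicity is attained for every finite graph. -/
theorem hasBoxRepresentation_boxicity {V : Type*} [Finite V] (G : SimpleGraph V) :
    HasBoxRepresentation G (boxicity G) :=
  Nat.sInf_mem (exists_hasBoxRepresentation G)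

/-! The bound proved is `72 * d * log (d * Δ)`; for large `d` the remaining factors of the target
only help. Giving each vertex of `A` a left ray and each vertex of `B` a right ray makes both
cliques automatic, so it suffices to find rank functions in which, for each nonadjacent `a`, `b`,
some rank puts `b` above all neighbours of `a`. Each vertex receives a symbol, encoded as a word of
length `s` over `2 * d` letters. Suppose the neighbours of `a` have distinct symbols and no word is
covered letter by letter by their other words. Then at some position the letter of `b` is shared by
at most one neighbour of `a`, namely one with the same symbol as `b`. Ranking the vertices with that
letter in one of two opposite orders separates `b`, using `2 * (2 * d) * s` ranks in total. A code
good for most symbol assignments exists by averaging (`exists_code_card_isBadAssignment_le`); with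
it fixed, the Local Lemma gives an assignment good at every `a`. As each event meets at most `d * Δ`
others, `s` of order `log (d * Δ)` suffices. -/

/-! ### Boxes from rank functions. -/

open Finset in
/-- A bipartite graph with cliques added on both sides is an intersection graph of boxes of dimension
`card κ` if every nonadjacent pair `a`, `b` is separated by one of `card κ` rank functions, in the
sense that `b` outranks all neighbours of `a`. -/
theorem boxicity_addCliques_le_card {V κ : Type*} [Fintype V] [Fintype κ] (G : SimpleGraph V)
    [DecidableRel G.Adj] {A B : Set V} (hG : G.IsBipartiteWith A B) (hAB : A ∪ B = Set.univ)
    (h : κ → V → ℕ)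
    (hsep : ∀ a ∈ A, ∀ b ∈ B, ¬ G.Adj a b →
      ∃ k, 0 < h k b ∧ ∀ b' ∈ G.neighborFinset a, h k b' < h k b) :
    boxicity (addCliques G A B) ≤ Fintype.card κ := by
  classical
  let e := Fintype.equivFin κ
  let I : V → Fin (Fintype.card κ) → Set ℝ := fun v i =>
    if v ∈ A then Set.Iic (((G.neighborFinset v).sup (h (e.symm i)) : ℕ) : ℝ)
    else Set.Ici ((h (e.symm i) v : ℕ) : ℝ)
  have hmem : ∀ v, v ∉ A → v ∈ B := fun v hv => by
    have : v ∈ A ∪ B := hAB ▸ Set.mem_univ v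
    exact this.resolve_left hv
  have hdis : ∀ v, v ∈ A → v ∉ B := fun v hv hv' => Set.disjoint_left.1 hG.disjoint hv hv'
  have hmix : ∀ a b, a ∈ A → b ∉ A → (G.Adj a b ↔ ∀ i, (I a i ∩ I b i).Nonempty) := by
    intro a b ha hb
    constructor
    · intro hadj i
      refine ⟨(h (e.symm i) b : ℕ), ?_, ?_⟩
      · simp only [I, ha, if_true, Set.mem_Iic, Nat.cast_le]
        exact le_sup (f := h (e.symm i)) (by simpa using hadj)
      · simp [I, hb]
    · intro hi
      by_contra hadj
      obtain ⟨k, hk0, hk⟩ := hsep a ha b (hmem b hb) hadj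
      obtain ⟨y, hy1, hy2⟩ := hi (e k)
      simp only [I, ha, hb, if_true, if_false, Set.mem_Iic, Set.mem_Ici,
        Equiv.symm_apply_apply] at hy1 hy2
      -- The supremum is 0 when `a` has no neighbours, hence the need for `0 < h k b`.
      have h1 : (G.neighborFinset a).sup (h k) < h k b := (Finset.sup_lt_iff hk0).2 hk
      have h2 : h k b ≤ (G.neighborFinset a).sup (h k) := by exact_mod_cast hy2.trans hy1
      omega
  refine Nat.sInf_le ⟨fun v => Set.univ.pi (I v), fun v => ⟨I v, fun i => ?_, rfl⟩, ?_⟩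
  · simp only [I]
    split_ifs
    · exact ⟨Set.nonempty_Iic, Set.ordConnected_Iic⟩
    · exact ⟨Set.nonempty_Ici, Set.ordConnected_Ici⟩
  · intro v w hvw
    rw [← Set.pi_inter_distrib, Set.univ_pi_nonempty_iff]
    by_cases hv : v ∈ A <;> by_cases hw : w ∈ A
    · refine iff_of_true (Or.inr ⟨hvw, Or.inr ⟨hdis v hv, hdis w hw⟩⟩) fun i => ?_
      simp only [I, hv, hw, if_true, Set.Iic_inter_Iic]
      exact Set.nonempty_Iic
    · rw [← hmix v w hv hw]
      simp [addCliques, hv, hmem w hw]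
    · simp only [Set.inter_comm (I v _)]
      rw [← hmix w v hw hv]
      simp [addCliques, hw, hmem v hv, G.adj_comm]
    · refine iff_of_true (Or.inr ⟨hvw, Or.inl ⟨hv, hw⟩⟩) fun i => ?_
      simp only [I, hv, hw, if_false, Set.Ici_inter_Ici]
      exact Set.nonempty_Ici

/-! ### The Local Lemma and independence of coordinates, by counting. -/

open Finset in
/-- The symmetric Lovász Local Lemma for the uniform distribution on a finite type: `N i` contains
the events on which `E i` may depend, apart from `E i` itself. -/
theorem exists_forall_notMem_of_local {Ω ι : Type*} [Fintype Ω] [Nonempty Ω] [Fintype ι]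
    [DecidableEq Ω] [DecidableEq ι] (E : ι → Finset Ω) (N : ι → Finset ι) (p D : ℝ)
    (hN : ∀ i, (#(N i) : ℝ) ≤ D)
    (hE : ∀ i, (#(E i) : ℝ) ≤ p * Fintype.card Ω) (hp : 0 ≤ p) (hp2 : 2 * p < 1)
    (hpD : 4 * p * D ≤ 1)
    (hind : ∀ i, ∀ S : Finset ι, i ∉ S → Disjoint S (N i) →
      #(E i ∩ ({ω | ∀ j ∈ S, ω ∉ E j} : Finset Ω)) * Fintype.card Ω = #(E i) * #({ω | ∀ j ∈ S, ω ∉ E j} : Finset Ω)) :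
    ∃ ω, ∀ i, ω ∉ E i := by
  let A : Finset ι → Finset Ω := fun S => {ω | ∀ j ∈ S, ω ∉ E j}
  have hΩ : (0 : ℝ) < Fintype.card Ω := by exact_mod_cast Fintype.card_pos
  -- Cleared of denominators: conditioned on avoiding `S`, the event `E i` has probability at most
  -- `2 * p`.
  have hstep : ∀ n : ℕ, ∀ S : Finset ι, #S = n → ∀ i, i ∉ S →
      (#(E i ∩ A S) : ℝ) ≤ 2 * p * #(A S) := by
    intro n
    induction n using Nat.strong_induction_on with
    | _ n ih =>
      intro S hS i hi
      have hsub : S \ N i ⊆ S := sdiff_subset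
      have hA : A S ⊆ A (S \ N i) := fun ω hω => by
        simp only [A, mem_filter, mem_univ, true_and] at hω ⊢
        exact fun j hj => hω j (hsub hj)
      have h1 : (#(E i ∩ A (S \ N i)) : ℝ) ≤ p * #(A (S \ N i)) := by
        have h2 : (#(E i ∩ A (S \ N i)) : ℝ) * Fintype.card Ω = #(E i) * #(A (S \ N i)) := by
          exact_mod_cast hind i (S \ N i) (fun h => hi (hsub h)) sdiff_disjoint
        have h3 := mul_le_mul_of_nonneg_right (hE i) (Nat.cast_nonneg (α := ℝ) #(A (S \ N i)))
        rw [← h2] at h3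
        refine le_of_mul_le_mul_right (h3.trans_eq ?_) hΩ
        ring
      have h2 : (#(E i ∩ A S) : ℝ) ≤ #(E i ∩ A (S \ N i)) := by
        exact_mod_cast card_le_card (inter_subset_inter_left hA)
      -- By induction, each event in `S ∩ N i` has conditional probability at most `2 * p` given `A
      -- (S \ N i)`; together they remove at most `2 * p * D ≤ 1 / 2` of it.
      have h3 : (#(A (S \ N i)) : ℝ) ≤ 2 * #(A S) := by
        by_cases hdj : S \ N i = S
        · rw [hdj]
          have : (0 : ℝ) ≤ #(A S) := Nat.cast_nonneg _
          linarith
        have hlt : #(S \ N i) < n := hS ▸ card_lt_card (hsub.ssubset_of_ne hdj)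
        have hcov : A (S \ N i) ⊆ A S ∪ (S ∩ N i).biUnion fun j => E j ∩ A (S \ N i) := by
          intro ω hω
          by_cases hωS : ω ∈ A S
          · exact mem_union_left _ hωS
          · refine mem_union_right _ ?_
            have hω' := hω
            simp only [A, mem_filter, mem_univ, true_and, not_forall, not_not, mem_sdiff]
              at hωS hω'
            obtain ⟨j, hj, hjE⟩ := hωS
            have hjN : j ∈ N i := by
              by_contra hjN
              exact hω' j ⟨hj, hjN⟩ hjE
            exact mem_biUnion.2 ⟨j, mem_inter.2 ⟨hj, hjN⟩, mem_inter.2 ⟨hjE, hω⟩⟩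
        have hc : (#(A (S \ N i)) : ℝ) ≤
            #(A S) + ∑ j ∈ S ∩ N i, (#(E j ∩ A (S \ N i)) : ℝ) := by
          exact_mod_cast (card_le_card hcov).trans
            ((card_union_le _ _).trans (Nat.add_le_add_left card_biUnion_le _))
        have hs : ∑ j ∈ S ∩ N i, (#(E j ∩ A (S \ N i)) : ℝ) ≤
            #(S ∩ N i) • (2 * p * #(A (S \ N i))) := by
          refine sum_le_card_nsmul _ _ _ fun j hj => ih _ hlt _ rfl j fun h => ?_
          exact (mem_sdiff.1 h).2 (mem_inter.1 hj).2
        have hcard : (#(S ∩ N i) : ℝ) ≤ D :=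
          le_trans (by exact_mod_cast card_le_card inter_subset_right) (hN i)
        have h4 : (#(S ∩ N i) : ℝ) * (2 * p * #(A (S \ N i))) ≤ D * (2 * p * #(A (S \ N i))) := by
          gcongr
        have h5 : (4 * p * D) * #(A (S \ N i)) ≤ 1 * #(A (S \ N i)) := by gcongr
        rw [nsmul_eq_mul] at hs
        linarith
      calc (#(E i ∩ A S) : ℝ) ≤ p * #(A (S \ N i)) := h2.trans h1
        _ ≤ p * (2 * #(A S)) := by gcongr
        _ = 2 * p * #(A S) := by ring
  have hpos : ∀ S : Finset ι, (A S).Nonempty := by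
    intro S
    induction S using Finset.induction_on with
    | empty => exact ⟨Classical.arbitrary Ω, by simp [A]⟩
    | insert i S hi ih =>
      by_contra hne
      have hsub : A S ⊆ E i ∩ A S := by
        intro ω hω
        refine mem_inter.2 ⟨?_, hω⟩
        by_contra hωi
        refine hne ⟨ω, ?_⟩
        simp only [A, mem_filter, mem_univ, true_and, mem_insert, forall_eq_or_imp] at hω ⊢
        exact ⟨hωi, hω⟩
      have h1 : (#(A S) : ℝ) ≤ #(E i ∩ A S) := by exact_mod_cast card_le_card hsub
      have h2 := hstep _ S rfl i hi
      have h3 : (0 : ℝ) < #(A S) := by exact_mod_cast card_pos.2 ih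
      nlinarith
  obtain ⟨ω, hω⟩ := hpos univ
  exact ⟨ω, fun i => by simpa [A] using (mem_filter.1 hω).2 i (mem_univ i)⟩

open Finset in
/-- Sets of functions determined by disjoint sets of coordinates are independent. -/
theorem card_inter_mul_card_of_coordinates {β γ : Type*} [Fintype β] [DecidableEq β] [Fintype γ]
    [DecidableEq γ] (E F : Finset (β → γ)) (T : Finset β)
    (hE : ∀ x y : β → γ, (∀ b ∈ T, x b = y b) → x ∈ E → y ∈ E)
    (hF : ∀ x y : β → γ, (∀ b, b ∉ T → x b = y b) → x ∈ F → y ∈ F) :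
    #(E ∩ F) * Fintype.card (β → γ) = #E * #F := by
  rw [← card_univ, ← card_product, ← card_product]
  -- Exchanging the coordinates outside `T` is an involution that matches `(E ∩ F) × univ` with `E ×
  -- F`.
  let φ : (β → γ) × (β → γ) → (β → γ) × (β → γ) := fun z =>
    (fun b => if b ∈ T then z.1 b else z.2 b, fun b => if b ∈ T then z.2 b else z.1 b)
  have hφ : ∀ z, φ (φ z) = z := by
    rintro ⟨x, y⟩
    ext b <;> by_cases hb : b ∈ T <;> simp [φ, hb]
  refine card_nbij' φ φ ?_ ?_ (fun z _ => hφ z) (fun z _ => hφ z)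
  · rintro ⟨x, y⟩ hz
    simp only [coe_product, Set.mem_prod, mem_coe, mem_inter, mem_univ, and_true] at hz ⊢
    exact ⟨hE x _ (fun b hb => by simp [φ, hb]) hz.1, hF x _ (fun b hb => by simp [φ, hb]) hz.2⟩
  · rintro ⟨x, y⟩ hz
    simp only [coe_product, Set.mem_prod, mem_coe, mem_inter, mem_univ, and_true] at hz ⊢
    exact ⟨hE x _ (fun b hb => by simp [φ, hb]) hz.1, hF y _ (fun b hb => by simp [φ, hb]) hz.2⟩

/-! ### Random codes and bad assignments. -/

-- A collision probability of at most `1 / card γ`: when `f t = f m`, the value at `t` can be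
-- overwritten by any symbol and still be recovered from the value at `m`.
open Finset in
theorem card_mul_card_filter_apply_eq_le {β γ : Type*} [Fintype β] [DecidableEq β] [Fintype γ]
    [DecidableEq γ] {t m : β} (htm : t ≠ m) :
    Fintype.card γ * #{f : β → γ | f t = f m} ≤ Fintype.card (β → γ) := by
  rw [← card_univ (α := γ), ← card_univ (α := β → γ), ← card_product]
  refine card_le_card_of_injOn (fun z => Function.update z.2 t z.1) (fun _ _ => mem_coe.2 (mem_univ _)) ?_
  rintro ⟨u, f⟩ hf ⟨v, g⟩ hg hfg
  simp only [coe_product, Set.mem_prod, mem_coe, mem_univ, true_and, mem_filter] at hf hg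
  simp only at hfg
  have h1 : u = v := by simpa using congrFun hfg t
  have h2 : ∀ b, b ≠ t → f b = g b := fun b hb => by simpa [hb] using congrFun hfg b
  refine Prod.ext h1 (funext fun b => ?_)
  by_cases hb : b = t
  · subst hb
    change f b = g b
    rw [hf, hg, h2 m htm.symm]
  · exact h2 b hb

open Finset in
/-- A random code with `2 * d` symbols: the proportion of codes of length `s` in which the
word of `m` is covered by the words of a set `T` of at most `d` others is at most `2⁻ˢ`. -/
theorem card_filter_covered_le {β : Type*} [Fintype β] [DecidableEq β] {d : ℕ} (hd : 0 < d) (s : ℕ)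
    (T : Finset β) (hT : #T ≤ d) (m : β) :
    2 ^ s * #{c : Fin s → β → Fin (2 * d) | ∀ j, ∃ t ∈ T, t ≠ m ∧ c j t = c j m} ≤
      Fintype.card (Fin s → β → Fin (2 * d)) := by
  -- Failure at a single position: at most `d` words, each agreeing with that of `m` with
  -- probability at most `1 / (2 * d)`, so at most `1 / 2` in all. Positions are independent, which
  -- gives the power `s`.
  let C : Finset (β → Fin (2 * d)) := {f | ∃ t ∈ T, t ≠ m ∧ f t = f m}
  have hC : 2 * #C ≤ Fintype.card (β → Fin (2 * d)) := by
    have hsub : C ⊆ (T.erase m).biUnion fun t => {f : β → Fin (2 * d) | f t = f m} := by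
      intro f hf
      obtain ⟨t, ht, htm, h⟩ := (mem_filter.1 hf).2
      exact mem_biUnion.2 ⟨t, mem_erase.2 ⟨htm, ht⟩, by simpa using h⟩
    have h1 : #C ≤ ∑ t ∈ T.erase m, #{f : β → Fin (2 * d) | f t = f m} :=
      (card_le_card hsub).trans card_biUnion_le
    have h2 : (2 * d) * #C ≤ d * Fintype.card (β → Fin (2 * d)) := by
      calc (2 * d) * #C ≤ ∑ t ∈ T.erase m, (2 * d) * #{f : β → Fin (2 * d) | f t = f m} := by
            rw [← mul_sum]; gcongr
        _ ≤ ∑ t ∈ T.erase m, Fintype.card (β → Fin (2 * d)) := by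
            refine sum_le_sum fun t ht => ?_
            have := card_mul_card_filter_apply_eq_le (γ := Fin (2 * d)) (ne_of_mem_erase ht)
            rwa [Fintype.card_fin] at this
        _ ≤ d * Fintype.card (β → Fin (2 * d)) := by
            rw [sum_const, smul_eq_mul]
            gcongr
            exact (card_le_card (erase_subset _ _)).trans hT
    refine Nat.le_of_mul_le_mul_left ?_ hd
    calc d * (2 * #C) = (2 * d) * #C := by ring
      _ ≤ _ := h2
  have hpi : ({c : Fin s → β → Fin (2 * d) | ∀ j, ∃ t ∈ T, t ≠ m ∧ c j t = c j m} : Finset _) =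
      Fintype.piFinset fun _ => C := by
    ext c
    simp [C, Fintype.mem_piFinset]
  rw [hpi, Fintype.card_piFinset_const, Fintype.card_fun (α := Fin s), Fintype.card_fin, ← mul_pow]
  exact Nat.pow_le_pow_left hC s

/-- The words assigned by `x` to the elements of `T` are not distinct, or some word of the code
`c` is covered, position by position, by other words assigned to elements of `T`. -/
def IsBadAssignment {V β γ : Type*} {s : ℕ} (c : Fin s → β → γ) (T : Finset V) (x : V → β) : Prop :=
  (∃ t ∈ T, ∃ u ∈ T, t ≠ u ∧ x t = x u) ∨ ∃ m, ∀ j, ∃ t ∈ T, x t ≠ m ∧ c j (x t) = c j m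

theorem IsBadAssignment.congr {V β γ : Type*} {s : ℕ} {c : Fin s → β → γ} {T : Finset V}
    {x y : V → β} (hxy : ∀ t ∈ T, x t = y t) (h : IsBadAssignment c T x) :
    IsBadAssignment c T y := by
  rcases h with ⟨t, ht, u, hu, h⟩ | ⟨m, h⟩
  · exact Or.inl ⟨t, ht, u, hu, by rwa [← hxy t ht, ← hxy u hu]⟩
  · refine Or.inr ⟨m, fun j => ?_⟩
    obtain ⟨t, ht, h⟩ := h j
    exact ⟨t, ht, by rwa [← hxy t ht]⟩

open Finset in
open scoped Classical in
/-- The number of bad assignments is monotone in the cardinality of the set. -/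
theorem card_isBadAssignment_le {V β γ : Type*} [Fintype V] [Fintype β] {s : ℕ}
    (c : Fin s → β → γ) {T U : Finset V} (hTU : #T ≤ #U) :
    #{x | IsBadAssignment c T x} ≤ #{x | IsBadAssignment c U x} := by
  obtain ⟨W, hWU, hW⟩ := exists_subset_card_eq hTU
  -- A permutation of `V` carrying `T` into `U` transports bad assignments injectively.
  let e : V ≃ V := (Finset.equivOfCardEq hW.symm).extendSubtype
  have he : ∀ t ∈ T, e t ∈ W := fun t ht => (Finset.equivOfCardEq hW.symm).extendSubtype_mem t ht
  refine card_le_card_of_injOn (fun x => x ∘ e.symm) ?_ ?_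
  · intro x hx
    simp only [mem_coe, mem_filter, mem_univ, true_and] at hx ⊢
    rcases hx with ⟨t, ht, u, hu, htu, h⟩ | ⟨m, h⟩
    · exact Or.inl ⟨e t, hWU (he t ht), e u, hWU (he u hu), e.injective.ne htu, by simpa using h⟩
    · refine Or.inr ⟨m, fun j => ?_⟩
      obtain ⟨t, ht, h⟩ := h j
      exact ⟨e t, hWU (he t ht), by simpa using h⟩
  · intro x _ y _ hxy
    exact e.symm.surjective.injective_comp_right hxy

open Finset in
open scoped Classical in
/-- There is a code for which few assignments are bad, for every set of at most `d` elements. -/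
theorem exists_code_card_isBadAssignment_le (V β : Type*) [Fintype V] [Fintype β] {d : ℕ}
    (hd : 0 < d) (s : ℕ) : ∃ c : Fin s → β → Fin (2 * d), ∀ T : Finset V, #T ≤ d →
      2 ^ s * Fintype.card β * #{x | IsBadAssignment c T x} ≤
        (2 ^ s * d ^ 2 + Fintype.card β ^ 2) * Fintype.card (V → β) := by
  -- By monotonicity in cardinality, one test set of the largest possible size controls every `T`,
  -- so no union bound over `T` is needed.
  obtain ⟨U, hU⟩ : ∃ U : Finset V, #U = min d (Fintype.card V) := by
    obtain ⟨U, -, hU⟩ := exists_subset_card_eq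
      (s := (univ : Finset V)) (n := min d (Fintype.card V)) (by rw [card_univ]; exact min_le_right _ _)
    exact ⟨U, hU⟩
  have hUd : #U ≤ d := hU ▸ min_le_left _ _
  let cov : (Fin s → β → Fin (2 * d)) → Finset (V → β) := fun c =>
    {x | ∃ m, ∀ j, ∃ t ∈ U, x t ≠ m ∧ c j (x t) = c j m}
  have : Nonempty (Fin (2 * d)) := ⟨⟨0, by omega⟩⟩
  -- Averaging over codes: for fixed `x` and `m`, a proportion of at most `2⁻ˢ` of the codes cover
  -- `m`; then sum over `m`.
  obtain ⟨c, hc⟩ : ∃ c, 2 ^ s * #(cov c) ≤ Fintype.card β * Fintype.card (V → β) := by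
    by_contra! hcon
    have hlt : ∑ c : Fin s → β → Fin (2 * d), Fintype.card β * Fintype.card (V → β) <
        ∑ c, 2 ^ s * #(cov c) := sum_lt_sum_of_nonempty univ_nonempty fun c _ => hcon c
    have hle : ∑ c, 2 ^ s * #(cov c) ≤ ∑ x : V → β, ∑ m : β,
        2 ^ s * #{c : Fin s → β → Fin (2 * d) |
          ∀ j, ∃ t ∈ U.image x, t ≠ m ∧ c j t = c j m} := by
      simp only [← mul_sum]
      gcongr
      have hdc : ∑ c, #(cov c) = ∑ x : V → β, #{c | x ∈ cov c} := by
        simp only [card_eq_sum_ones, sum_filter, cov]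
        rw [← sum_comm]
        simp
      rw [hdc]
      refine sum_le_sum fun x _ => (card_le_card fun c hc => ?_).trans card_biUnion_le
      simp only [cov, mem_filter, mem_univ, true_and] at hc
      obtain ⟨m, h⟩ := hc
      refine mem_biUnion.2 ⟨m, mem_univ _, ?_⟩
      simpa using h
    have hle2 : ∑ x : V → β, ∑ m : β, 2 ^ s * #{c : Fin s → β → Fin (2 * d) |
          ∀ j, ∃ t ∈ U.image x, t ≠ m ∧ c j t = c j m} ≤
        ∑ x : V → β, ∑ m : β, Fintype.card (Fin s → β → Fin (2 * d)) :=
      sum_le_sum fun x _ => sum_le_sum fun m _ =>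
        card_filter_covered_le hd s _ (card_image_le.trans hUd) m
    have := hlt.trans_le (hle.trans hle2)
    simp only [sum_const, smul_eq_mul, card_univ] at this
    refine lt_irrefl _ (this.trans_eq ?_)
    ring
  refine ⟨c, fun T hT => ?_⟩
  have hTU : #T ≤ #U := hU ▸ le_min hT (card_le_univ T)
  have hcol : Fintype.card β * #{x : V → β | ∃ t ∈ U, ∃ u ∈ U, t ≠ u ∧ x t = x u} ≤
      d ^ 2 * Fintype.card (V → β) := by
    have hsub : ({x : V → β | ∃ t ∈ U, ∃ u ∈ U, t ≠ u ∧ x t = x u} : Finset _) ⊆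
        U.offDiag.biUnion fun z => {x : V → β | x z.1 = x z.2} := by
      intro x hx
      obtain ⟨t, ht, u, hu, htu, h⟩ := (mem_filter.1 hx).2
      exact mem_biUnion.2 ⟨(t, u), mem_offDiag.2 ⟨ht, hu, htu⟩, by simpa using h⟩
    calc _ ≤ Fintype.card β * ∑ z ∈ U.offDiag, #{x : V → β | x z.1 = x z.2} := by
          gcongr
          exact (card_le_card hsub).trans card_biUnion_le
      _ = ∑ z ∈ U.offDiag, Fintype.card β * #{x : V → β | x z.1 = x z.2} := mul_sum _ _ _
      _ ≤ ∑ z ∈ U.offDiag, Fintype.card (V → β) := sum_le_sum fun z hz =>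
          card_mul_card_filter_apply_eq_le (mem_offDiag.1 hz).2.2
      _ = #U.offDiag * Fintype.card (V → β) := by simp
      _ ≤ d ^ 2 * Fintype.card (V → β) := by
          gcongr
          rw [offDiag_card, sq]
          exact (Nat.sub_le _ _).trans (Nat.mul_le_mul hUd hUd)
  have hsplit : #{x | IsBadAssignment c U x} ≤
      #{x : V → β | ∃ t ∈ U, ∃ u ∈ U, t ≠ u ∧ x t = x u} + #(cov c) := by
    refine (card_le_card fun x hx => ?_).trans (card_union_le _ _)
    simp only [mem_union, cov, mem_filter, mem_univ, true_and] at hx ⊢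
    exact hx
  calc _ ≤ 2 ^ s * Fintype.card β *
        (#{x : V → β | ∃ t ∈ U, ∃ u ∈ U, t ≠ u ∧ x t = x u} + #(cov c)) := by
        gcongr
        exact (card_isBadAssignment_le c hTU).trans hsplit
    _ = 2 ^ s * (Fintype.card β * #{x : V → β | ∃ t ∈ U, ∃ u ∈ U, t ≠ u ∧ x t = x u}) +
        Fintype.card β * (2 ^ s * #(cov c)) := by ring
    _ ≤ 2 ^ s * (d ^ 2 * Fintype.card (V → β)) +
        Fintype.card β * (Fintype.card β * Fintype.card (V → β)) := by gcongr
    _ = _ := by ring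

/-! ### From codes to boxicity. -/

open Finset in
/-- If `x` is not bad on any neighbourhood `N(a)`, then listing each class of each position of the
code last, in two opposite orders, gives a box representation. -/
theorem boxicity_addCliques_le_of_code {V β : Type*} [Fintype V] (G : SimpleGraph V)
    [DecidableRel G.Adj] {A B : Set V} (hG : G.IsBipartiteWith A B) (hAB : A ∪ B = Set.univ)
    {r s : ℕ} (c : Fin s → β → Fin r) (x : V → β)
    (hx : ∀ a ∈ A, ¬ IsBadAssignment c (G.neighborFinset a) x) :
    boxicity (addCliques G A B) ≤ 2 * r * s := by
  classical
  let e := Fintype.equivFin V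
  -- Rank 0 is kept for vertices with another letter; both orders give positive ranks inside the
  -- class because `e v < card V`.
  let h : Fin s × Fin r × Bool → V → ℕ := fun k v =>
    if c k.1 (x v) = k.2.1 then
      (if k.2.2 then (e v : ℕ) + 1 else Fintype.card V - (e v : ℕ)) else 0
  have hcard : Fintype.card (Fin s × Fin r × Bool) = 2 * r * s := by
    simp only [Fintype.card_prod, Fintype.card_fin, Fintype.card_bool]
    ring
  rw [← hcard]
  refine boxicity_addCliques_le_card G hG hAB h fun a ha b _ hab => ?_
  have hgood := hx a ha
  simp only [IsBadAssignment, not_or, not_exists, not_and, not_forall] at hgood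
  obtain ⟨hinj, hcov⟩ := hgood
  obtain ⟨j, hj⟩ := hcov (x b)
  have hb := (e b).2
  -- Symbols are distinct on the neighbourhood, so at most one such `u` exists; the Boolean selects
  -- the order placing `b` above it.
  by_cases hex : ∃ u ∈ G.neighborFinset a, x u = x b
  · obtain ⟨u, hu, hub⟩ := hex
    have hne : (e u : ℕ) ≠ e b := by
      intro h'
      have : u = b := e.injective (Fin.ext h')
      subst this
      exact hab (by simpa using hu)
    refine ⟨(j, c j (x b), decide ((e u : ℕ) < e b)), ?_, fun w hw => ?_⟩
    · simp only [h, if_true]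
      split_ifs <;> omega
    · by_cases hwu : w = u
      · subst hwu
        simp only [h, hub, if_true, decide_eq_true_eq]
        split_ifs <;> omega
      · have hxw : x w ≠ x b := fun h' => hinj w hw u hu hwu (h'.trans hub.symm)
        simp only [h, hj w hw hxw, if_true, if_false]
        split_ifs <;> omega
  · push Not at hex
    refine ⟨(j, c j (x b), true), by simp [h], fun w hw => ?_⟩
    simp [h, hj w hw (hex w hw)]

open Finset in
/-- If `2 ^ s` is at least `64 (dΔ)⁴` then the boxicity is at most `4ds`. -/
theorem boxicity_addCliques_le_mul {V : Type*} [Fintype V] (G : SimpleGraph V)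
    [DecidableRel G.Adj] {A B : Set V} (hG : G.IsBipartiteWith A B) (hAB : A ∪ B = Set.univ)
    {d Δ s : ℕ} (hd : 1 ≤ d) (hΔ : 1 ≤ Δ) (hA : ∀ v ∈ A, G.degree v ≤ d)
    (hB : ∀ w ∈ B, G.degree w ≤ Δ) (hs : 64 * (d * Δ) ^ 4 ≤ 2 ^ s) :
    boxicity (addCliques G A B) ≤ 4 * d * s := by
  classical
  -- Collisions then have probability at most `d ^ 2 / M = 1 / (8 * d * Δ)`. Covering has at most `M
  -- / 2 ^ s`, which the choice of `s` bounds by the same amount. The total is the `1 / (4 * d * Δ)`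
  -- that the Local Lemma tolerates.
  let M := 8 * d ^ 3 * Δ
  have hM : 0 < M := by positivity
  have : Nonempty (Fin M) := ⟨⟨0, hM⟩⟩
  obtain ⟨c, hc⟩ := exists_code_card_isBadAssignment_le V (Fin M) hd s
  let E : A → Finset (V → Fin M) := fun a => {x | IsBadAssignment c (G.neighborFinset a) x}
  let N : A → Finset A := fun a =>
    {a' | ¬ Disjoint (G.neighborFinset (a : V)) (G.neighborFinset (a' : V))}
  have hNcard : ∀ a, #(N a) ≤ d * Δ := by
    intro a
    have hsub : (N a).map (Function.Embedding.subtype _) ⊆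
        (G.neighborFinset (a : V)).biUnion fun b => G.neighborFinset b := by
      intro v hv
      obtain ⟨a', ha', rfl⟩ := mem_map.1 hv
      obtain ⟨b, hb, hb'⟩ := not_disjoint_iff.1 (mem_filter.1 ha').2
      refine mem_biUnion.2 ⟨b, hb, ?_⟩
      rw [SimpleGraph.mem_neighborFinset] at hb' ⊢
      exact hb'.symm
    rw [← card_map (Function.Embedding.subtype _)]
    refine (card_le_card hsub).trans (card_biUnion_le_card_mul _ _ Δ fun b hb => ?_) |>.trans ?_
    · exact hB b (hG.mem_of_mem_adj a.2 (by simpa using hb))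
    · exact Nat.mul_le_mul_right _ (hA a a.2)
  have hdR : (1 : ℝ) ≤ d := by exact_mod_cast hd
  have hΔR : (1 : ℝ) ≤ Δ := by exact_mod_cast hΔ
  have hdΔ : (1 : ℝ) ≤ d * Δ := one_le_mul_of_one_le_of_one_le hdR hΔR
  have hEcard : ∀ a, (#(E a) : ℝ) ≤ 1 / (4 * (d * Δ)) * Fintype.card (V → Fin M) := by
    intro a
    have h1 := hc (G.neighborFinset (a : V)) (hA a a.2)
    rw [Fintype.card_fin] at h1
    have hkey : 4 * (d * Δ) * (2 ^ s * d ^ 2 + M ^ 2) ≤ 2 ^ s * M := by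
      have h2 : 4 * (d * Δ) * M ^ 2 ≤ 2 ^ s * (4 * d ^ 3 * Δ) := by
        calc 4 * (d * Δ) * M ^ 2 = 64 * (d ^ 4 * Δ ^ 2 * 1) * (4 * d ^ 3 * Δ) := by
              simp only [M]; ring
          _ ≤ 64 * (d ^ 4 * Δ ^ 2 * Δ ^ 2) * (4 * d ^ 3 * Δ) := by
              gcongr
              exact Nat.one_le_pow _ _ hΔ
          _ = 64 * (d * Δ) ^ 4 * (4 * d ^ 3 * Δ) := by ring
          _ ≤ _ := by gcongr
      calc 4 * (d * Δ) * (2 ^ s * d ^ 2 + M ^ 2)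
          = 2 ^ s * (4 * d ^ 3 * Δ) + 4 * (d * Δ) * M ^ 2 := by ring
        _ ≤ 2 ^ s * (4 * d ^ 3 * Δ) + 2 ^ s * (4 * d ^ 3 * Δ) := by gcongr
        _ = 2 ^ s * M := by simp only [M]; ring
    have h3 : 2 ^ s * M * (4 * (d * Δ) * #(E a)) ≤ 2 ^ s * M * Fintype.card (V → Fin M) := by
      calc 2 ^ s * M * (4 * (d * Δ) * #(E a)) = 4 * (d * Δ) * (2 ^ s * M * #(E a)) := by ring
        _ ≤ 4 * (d * Δ) * ((2 ^ s * d ^ 2 + M ^ 2) * Fintype.card (V → Fin M)) := by gcongr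
        _ = 4 * (d * Δ) * (2 ^ s * d ^ 2 + M ^ 2) * Fintype.card (V → Fin M) := by ring
        _ ≤ _ := by gcongr
    have h4 : 4 * ((d : ℝ) * Δ) * #(E a) ≤ Fintype.card (V → Fin M) := by
      exact_mod_cast Nat.le_of_mul_le_mul_left h3 (by positivity)
    rw [one_div, inv_mul_eq_div, le_div_iff₀ (by positivity)]
    linarith
  obtain ⟨x, hx⟩ := exists_forall_notMem_of_local E N (1 / (4 * (d * Δ))) (d * Δ)
    (fun a => by exact_mod_cast hNcard a) hEcard (by positivity)
    (by
      rw [← mul_div_assoc, div_lt_one (by positivity)]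
      linarith)
    (by
      refine le_of_eq ?_
      field_simp)
    (by
      intro a S _ hS
      -- Badness at `a` depends only on the symbols of its neighbours, and the events in `S` only on
      -- symbols of other vertices.
      refine card_inter_mul_card_of_coordinates _ _ (G.neighborFinset (a : V)) ?_ ?_
      · intro x y hxy hx
        simp only [E, mem_filter, mem_univ, true_and] at hx ⊢
        exact hx.congr hxy
      · intro x y hxy hx
        simp only [E, mem_filter, mem_univ, true_and] at hx ⊢
        intro j hj hy
        refine hx j hj (hy.congr fun t ht => (hxy t fun hta => ?_).symm)
        refine disjoint_left.1 hS hj (mem_filter.2 ⟨mem_univ _, ?_⟩)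
        exact not_disjoint_iff.2 ⟨t, hta, ht⟩)
  have := boxicity_addCliques_le_of_code G hG hAB c x fun a ha hbad =>
    hx ⟨a, ha⟩ (mem_filter.2 ⟨mem_univ _, hbad⟩)
  calc _ ≤ 2 * (2 * d) * s := this
    _ = 4 * d * s := by ring

/-! ### Numerical estimates. -/

theorem boxicity_addCliques_le_log {V : Type*} [Fintype V] (G : SimpleGraph V)
    [DecidableRel G.Adj] {A B : Set V} (hG : G.IsBipartiteWith A B) (hAB : A ∪ B = Set.univ)
    {d Δ : ℕ} (hd : 2 ≤ d) (hΔ : 2 ≤ Δ) (hA : ∀ v ∈ A, G.degree v ≤ d)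
    (hB : ∀ w ∈ B, G.degree w ≤ Δ) :
    (boxicity (addCliques G A B) : ℝ) ≤ 72 * d * Real.log (d * Δ) := by
  have h4 : 2 ^ 2 ≤ d * Δ := Nat.mul_le_mul hd hΔ
  have hne : d * Δ ≠ 0 := by omega
  let L := Nat.log 2 (d * Δ)
  have hL : 2 ≤ L := Nat.le_log_of_pow_le (by norm_num) h4
  have hs : 64 * (d * Δ) ^ 4 ≤ 2 ^ (4 * L + 10) := by
    calc 64 * (d * Δ) ^ 4 ≤ 64 * (2 ^ (L + 1)) ^ 4 := by
          gcongr
          exact (Nat.lt_pow_succ_log_self (by norm_num) _).le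
      _ = 2 ^ (4 * L + 10) := by ring
  have hbox := boxicity_addCliques_le_mul G hG hAB (by omega) (by omega) hA hB hs
  -- Uses `1 / log 2 < 2`.
  have hlog : (L : ℝ) ≤ 2 * Real.log (d * Δ) := by
    have h1 : ((2 ^ L : ℕ) : ℝ) ≤ ((d * Δ : ℕ) : ℝ) :=
      Nat.cast_le.2 (Nat.pow_log_le_self 2 hne)
    have h2 := Real.log_le_log (by positivity) h1
    push_cast at h2
    rw [Real.log_pow] at h2
    have h3 := Real.log_two_gt_d9
    have h5 : (0 : ℝ) ≤ L := Nat.cast_nonneg _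
    nlinarith
  calc (boxicity (addCliques G A B) : ℝ) ≤ ((4 * d * (4 * L + 10) : ℕ) : ℝ) := Nat.cast_le.2 hbox
    _ ≤ ((4 * d * (9 * L) : ℕ) : ℝ) := by
        refine Nat.cast_le.2 (Nat.mul_le_mul_left _ ?_)
        omega
    _ = 36 * d * L := by push_cast; ring
    _ ≤ 36 * d * (2 * Real.log (d * Δ)) := by gcongr
    _ = 72 * d * Real.log (d * Δ) := by ring

theorem lemma3p4 :
    ∀ ε : ℝ, 0 < ε → ∃ d₀ : ℕ, ∀ d Δ : ℕ, d₀ ≤ d → 2 ≤ d → d ≤ Δ →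
      ∀ (V : Type*) [Fintype V] (G : SimpleGraph V) [DecidableRel G.Adj] (A B : Set V),
        G.IsBipartiteWith A B → A ∪ B = Set.univ →
        (∀ v ∈ A, G.degree v ≤ d) → (∀ w ∈ B, G.degree w ≤ Δ) →
        (boxicity (addCliques G A B) : ℝ) ≤
          (60 + ε) * (d : ℝ) * Real.log ((d : ℝ) * (Δ : ℝ)) * Real.log (Real.log (Δ : ℝ)) *
            (2 * Real.exp 1) ^ Real.sqrt (Real.log (d : ℝ)) := by
  intro ε hε
  -- This threshold gives `log (log Δ) ≥ 2`, so that `60 * 2` already exceeds 72, the last factor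
  -- being at least 1.
  refine ⟨⌈Real.exp (Real.exp 2)⌉₊, fun d Δ hd₀ hd hdΔ V _ G _ A B hG hAB hA hB => ?_⟩
  have hbox := boxicity_addCliques_le_log G hG hAB hd (hd.trans hdΔ) hA hB
  have h1 : Real.exp (Real.exp 2) ≤ Δ :=
    (Nat.le_ceil _).trans (Nat.cast_le.2 (hd₀.trans hdΔ))
  have h2 : Real.exp 2 ≤ Real.log Δ :=
    (Real.le_log_iff_exp_le ((Real.exp_pos _).trans_le h1)).2 h1
  have h3 : 2 ≤ Real.log (Real.log Δ) :=
    (Real.le_log_iff_exp_le ((Real.exp_pos _).trans_le h2)).2 h2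
  have h4 : 1 ≤ (2 * Real.exp 1) ^ Real.sqrt (Real.log (d : ℝ)) := by
    refine Real.one_le_rpow ?_ (Real.sqrt_nonneg _)
    have := Real.add_one_le_exp (1 : ℝ)
    linarith
  have hlog : 0 ≤ Real.log ((d : ℝ) * Δ) := by
    have : (1 : ℝ) ≤ ((d * Δ : ℕ) : ℝ) := by
      have : 0 < d * Δ := Nat.mul_pos (by omega) (by omega)
      exact_mod_cast this
    refine Real.log_nonneg ?_
    exact_mod_cast this
  calc (boxicity (addCliques G A B) : ℝ) ≤ 72 * d * Real.log (d * Δ) := hbox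
    _ ≤ 60 * d * Real.log (d * Δ) * 2 * 1 := by
        have : 0 ≤ d * Real.log ((d : ℝ) * Δ) := by positivity
        linarith
    _ ≤ _ := by
        gcongr
        linarith
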